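/- Let $q$ be a complex number with $|q|<1$. Write $(a;q)_n=\prod_{j=0}^{n-1}(1-aq^j)$ and $(a;q)_\infty=\prod_{j=0}^{\infty}(1-aq^j)$, abbreviate $(a)_n=(a;q)_n$ and $(a)_\infty=(a;q)_\infty$, put $(a,b,c;q)_\infty=(a;q)_\infty(b;q)_\infty(c;q)_\infty$, and let ${n\brack k}=\frac{(q)_n}{(q)_k(q)_{n-k}}$ for $0\le k\le n$. Then $$\sum_{n=0}^{\infty}\ \sum_{m=-\lfloor\frac{n+1}{2}\rfloor}^{\lfloor\frac n2\rfloor}\frac{(-1)^m q^{n(n+1)/2+m(5m+3)/2}}{(q)_n\,(q;q^2)_{n+1}}{2n+1\brack n-2m}=\frac{(-q)_\infty\,(q^2,q^7,q^9;q^9)_\infty}{(q)_\infty}$$ and $$\sum_{n=0}^{\infty}\ \sum_{m=-\lfloor\frac{n+1}{2}\rfloor}^{\lfloor\frac n2\rfloor}\frac{(-1)^m q^{n^2+m(5m+3)/2}}{(q)_{2n+1}}{2n+1\brack n-2m}=\frac{(q^5,q^8,q^{13};q^{13})_\infty+q\,(q,q^{12},q^{13};q^{13})_\infty}{(q)_\infty},$$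 where both series over $n$ converge absolutely. -/

import Mathlib

open Finset

noncomputable section

/-- The finite `q`-shifted factorial `(a; q)_n = ∏_{j=0}^{n-1} (1 - a q^j)`. -/
def qPoch (a q : ℂ) (n : ℕ) : ℂ := ∏ j ∈ Finset.range n, (1 - a * q ^ j)

/-- The infinite `q`-shifted factorial `(a; q)_∞ = ∏_{n ≥ 0} (1 - a q^n)`. -/
def qPochInf (a q : ℂ) : ℂ := ∏' n : ℕ, (1 - a * q ^ n)

/-- The compact notation `(a, b, c; q)_∞ = (a; q)_∞ (b; q)_∞ (c; q)_∞`. -/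
def qPochInf₃ (a b c q : ℂ) : ℂ := qPochInf a q * qPochInf b q * qPochInf c q

/-- The `q`-binomial coefficient `(q; q)_n / ((q; q)_k (q; q)_{n-k})` for `0 ≤ k ≤ n`, and `0` for
all other integers `k`. -/
def qBinom (q : ℂ) (n : ℕ) (k : ℤ) : ℂ :=
  if 0 ≤ k ∧ k ≤ n then
    qPoch q q n / (qPoch q q k.toNat * qPoch q q (n - k.toNat))
  else 0

/-- For `|q| < 1` the infinite product defining `(a; q)_∞` converges. -/
theorem multipliable_qPochInf (a q : ℂ) (hq : ‖q‖ < 1) :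
    Multipliable fun n : ℕ => 1 - a * q ^ n := by
  have h : Summable fun n : ℕ => ‖-(a * q ^ n)‖ := by
    simpa [norm_mul, norm_pow] using
      (summable_geometric_of_lt_one (norm_nonneg q) hq).mul_left ‖a‖
  simpa [sub_eq_add_neg] using multipliable_one_add_of_summable h

end

/-! Both identities are Bailey's transform at a = q with the same α_m = (-1)^m q^(m(5m+3)/2); the
inner sums over m are β_n, and no closed form for them is needed. Exchanging the order of summation
(`hasSum_bailey`) turns Σ β_n δ_n into Σ α_m γ_r, where r = 2m or r = -2m-1. For δ_n = q^(n(n+1)/2)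
(-q)_n, γ_r comes from the limiting q-Gauss sum (`hasSum_gauss_neg`); for δ_n = q^(n²), from
Cauchy's sum (`hasSum_cauchy_succ`). The resulting theta series have quadratic coefficient 9/2 and
13/2, and Jacobi's triple product (`hasSum_jacobi_pow`) evaluates them. The only summation formula
proved from scratch is the q-Gauss limit `hasSum_phiTerm`: c = 0 gives Euler's expansion, b = 0
gives Cauchy's sum, and these two together give Jacobi's identity. -/

/-! ### Finite and infinite q-shifted factorials -/

theorem qPoch_succ (a q : ℂ) (n : ℕ) : qPoch a q (n + 1) = qPoch a q n * (1 - a * q ^ n) :=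
  Finset.prod_range_succ _ _

@[simp] theorem qPoch_zero (a q : ℂ) : qPoch a q 0 = 1 := rfl

theorem qPoch_add (a q : ℂ) (m n : ℕ) :
    qPoch a q (m + n) = qPoch a q m * qPoch (a * q ^ m) q n := by
  simp only [qPoch, Finset.prod_range_add]
  congr 1
  exact Finset.prod_congr rfl fun i _ => by ring

theorem qPoch_succ' (a q : ℂ) (n : ℕ) : qPoch a q (n + 1) = (1 - a) * qPoch (a * q) q n := by
  rw [add_comm, qPoch_add]; simp [qPoch]

theorem one_sub_mul_pow_ne_zero {a q : ℂ} (ha : ‖a‖ < 1) (hq : ‖q‖ < 1) (n : ℕ) :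
    1 - a * q ^ n ≠ 0 := by
  intro h
  have h1 : ‖a * q ^ n‖ < 1 := by
    rw [norm_mul, norm_pow]
    exact mul_lt_one_of_nonneg_of_lt_one_left (norm_nonneg _) ha
      (pow_le_one₀ (norm_nonneg _) hq.le)
  rw [← sub_eq_zero.mp h] at h1
  simp at h1

theorem qPoch_ne_zero {a q : ℂ} (ha : ‖a‖ < 1) (hq : ‖q‖ < 1) (n : ℕ) : qPoch a q n ≠ 0 :=
  Finset.prod_ne_zero_iff.mpr fun i _ => one_sub_mul_pow_ne_zero ha hq i

theorem qPochInf_ne_zero {a q : ℂ} (ha : ‖a‖ < 1) (hq : ‖q‖ < 1) : qPochInf a q ≠ 0 := by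
  have h : Summable fun n : ℕ => ‖-(a * q ^ n)‖ := by
    simpa [norm_mul, norm_pow] using
      (summable_geometric_of_lt_one (norm_nonneg q) hq).mul_left ‖a‖
  have := tprod_one_add_ne_zero_of_summable (f := fun n : ℕ => -(a * q ^ n))
    (fun n => by simpa [sub_eq_add_neg] using one_sub_mul_pow_ne_zero ha hq n) h
  simpa [qPochInf, sub_eq_add_neg] using this

theorem tendsto_qPoch (a : ℂ) {q : ℂ} (hq : ‖q‖ < 1) :
    Filter.Tendsto (qPoch a q) Filter.atTop (nhds (qPochInf a q)) :=
  (multipliable_qPochInf a q hq).tendsto_prod_tprod_nat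

theorem exists_norm_qPoch_le (a : ℂ) {q : ℂ} (hq : ‖q‖ < 1) :
    ∃ M : ℝ, 0 < M ∧ ∀ n, ‖qPoch a q n‖ ≤ M := by
  obtain ⟨M, h0, hM⟩ :=
    (Metric.isBounded_range_of_tendsto _ (tendsto_qPoch a hq)).exists_pos_norm_le
  exact ⟨M, h0, fun n => hM _ ⟨n, rfl⟩⟩

theorem exists_norm_inv_qPoch_le {a q : ℂ} (ha : ‖a‖ < 1) (hq : ‖q‖ < 1) :
    ∃ M : ℝ, 0 < M ∧ ∀ n, ‖(qPoch a q n)⁻¹‖ ≤ M := by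
  obtain ⟨M, h0, hM⟩ := (Metric.isBounded_range_of_tendsto _
    ((tendsto_qPoch a hq).inv₀ (qPochInf_ne_zero ha hq))).exists_pos_norm_le
  exact ⟨M, h0, fun n => hM _ ⟨n, rfl⟩⟩

theorem qPochInf_eq_mul (a : ℂ) {q : ℂ} (hq : ‖q‖ < 1) (m : ℕ) :
    qPochInf a q = qPoch a q m * qPochInf (a * q ^ m) q := by
  refine tendsto_nhds_unique ((Filter.tendsto_add_atTop_iff_nat m).mpr (tendsto_qPoch a hq)) ?_
  simp_rw [add_comm _ m, qPoch_add]
  exact (tendsto_qPoch _ hq).const_mul _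

/-! ### The limiting q-Gauss sum -/

/-- The general term of the `₁φ₁` series `∑ (c/b)_j (-b)^j q^{j(j-1)/2} / ((q)_j (c)_j)`, written so
that it makes sense for `b = 0`. -/
noncomputable def phiTerm (q b c : ℂ) (j : ℕ) : ℂ :=
  (-1) ^ j * q ^ j.choose 2 * (∏ i ∈ range j, (b - c * q ^ i)) / (qPoch q q j * qPoch c q j)

theorem phiTerm_succ {q c : ℂ} (b : ℂ) (j : ℕ) :
    phiTerm q b c (j + 1) =
      phiTerm q b c j * (-(q ^ j * (b - c * q ^ j)) / ((1 - q * q ^ j) * (1 - c * q ^ j))) := by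
  simp only [phiTerm, prod_range_succ, qPoch_succ, Nat.choose_succ_succ j 1, Nat.choose_one_right,
    pow_add]
  rw [div_mul_div_comm]
  congr 1 <;> ring

theorem phiTerm_shift {q c : ℂ} (hq : ‖q‖ < 1) (hc : ‖c‖ < 1) (b : ℂ) (j : ℕ) :
    phiTerm q (b * q) (c * q) j = phiTerm q b c j * (q ^ j * (1 - c) / (1 - c * q ^ j)) := by
  have h1 := qPoch_succ c q j
  have h2 := qPoch_succ' c q j
  have hcj := one_sub_mul_pow_ne_zero hc hq j
  have hc0 : 1 - c ≠ 0 := by simpa using one_sub_mul_pow_ne_zero hc hq 0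
  have hP := qPoch_ne_zero hc hq j
  have h3 : qPoch (c * q) q j = qPoch c q j * (1 - c * q ^ j) / (1 - c) := by
    rw [eq_div_iff hc0, ← h1, h2]; ring
  have h4 : ∏ i ∈ range j, (b * q - c * q * q ^ i) = q ^ j * ∏ i ∈ range j, (b - c * q ^ i) := by
    rw [← card_range j, ← prod_const, card_range, ← prod_mul_distrib]
    exact prod_congr rfl fun i _ => by ring
  have hQ := qPoch_ne_zero hq hq j
  simp only [phiTerm, h3, h4]
  field_simp

/-- Telescoping certificate for the relation between (b, c) and (bq, cq): the right side is u_j -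
u_(j+1), with u_0 = 0 and u_j → 0. -/
theorem phiTerm_telescope {q c : ℂ} (hq : ‖q‖ < 1) (hc : ‖c‖ < 1) (b : ℂ) (j : ℕ) :
    (1 - c) * phiTerm q b c j - (1 - b) * phiTerm q (b * q) (c * q) j =
      (1 - c) * (1 - q ^ j) * phiTerm q b c j -
        (1 - c) * (1 - q ^ (j + 1)) * phiTerm q b c (j + 1) := by
  have hcj := one_sub_mul_pow_ne_zero hc hq j
  have hqj := one_sub_mul_pow_ne_zero hq hq j
  rw [phiTerm_shift hq hc, phiTerm_succ, pow_succ' q j]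
  generalize q ^ j = x at *
  generalize 1 - q * x = y at *
  field_simp
  ring

theorem summable_pow_choose_two {r : ℝ} (h0 : 0 ≤ r) (hr : r < 1) (A : ℝ) :
    Summable fun j : ℕ => r ^ j.choose 2 * A ^ j := by
  refine summable_of_ratio_norm_eventually_le (r := 1 / 2) (by norm_num) ?_
  have h : Filter.Tendsto (fun j : ℕ => r ^ j * |A|) Filter.atTop (nhds 0) := by
    simpa using (tendsto_pow_atTop_nhds_zero_of_lt_one h0 hr).mul_const |A|
  filter_upwards [h.eventually_le_const (by norm_num : (0 : ℝ) < 1 / 2)] with j hj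
  have : r ^ (j + 1).choose 2 * A ^ (j + 1) = (r ^ j * A) * (r ^ j.choose 2 * A ^ j) := by
    rw [Nat.choose_succ_succ j 1, Nat.choose_one_right, pow_add]; ring
  rw [this, norm_mul]
  refine mul_le_mul_of_nonneg_right ?_ (norm_nonneg _)
  rwa [Real.norm_eq_abs, abs_mul, abs_of_nonneg (pow_nonneg h0 j)]

/-- The bound is uniform in N, as dominated convergence requires; the shifted denominator is
controlled through (cq^N)_j = (c)_(N+j) / (c)_N. -/
theorem exists_phiTerm_bound {q c : ℂ} (hq : ‖q‖ < 1) (hc : ‖c‖ < 1) (b : ℂ) :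
    ∃ M : ℝ, ∀ N j : ℕ, ‖phiTerm q (b * q ^ N) (c * q ^ N) j‖ ≤
      M * (‖q‖ ^ j.choose 2 * (‖b‖ + ‖c‖) ^ j) := by
  obtain ⟨M₁, h1, hM₁⟩ := exists_norm_inv_qPoch_le hq hq
  obtain ⟨M₂, h2, hM₂⟩ := exists_norm_inv_qPoch_le hc hq
  obtain ⟨M₃, h3, hM₃⟩ := exists_norm_qPoch_le c hq
  refine ⟨M₁ * (M₃ * M₂), fun N j => ?_⟩
  have hinv : (qPoch (c * q ^ N) q j)⁻¹ = qPoch c q N * (qPoch c q (N + j))⁻¹ := by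
    rw [qPoch_add, mul_inv, mul_inv_cancel_left₀ (qPoch_ne_zero hc hq N)]
  have hp (n : ℕ) : ‖q‖ ^ n ≤ 1 := pow_le_one₀ (norm_nonneg _) hq.le
  have hprod : ‖∏ i ∈ range j, (b * q ^ N - c * q ^ N * q ^ i)‖ ≤ (‖b‖ + ‖c‖) ^ j := by
    rw [norm_prod]
    refine (prod_le_prod (fun i _ => norm_nonneg _) fun i _ => ?_).trans
      (by rw [prod_const, card_range])
    refine (norm_sub_le _ _).trans ?_
    simp only [norm_mul, norm_pow]
    have := mul_le_mul (hp N) (hp i) (by positivity) zero_le_one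
    refine add_le_add (mul_le_of_le_one_right (norm_nonneg _) (hp N)) ?_
    rw [mul_assoc]
    exact mul_le_of_le_one_right (norm_nonneg _) (by simpa using this)
  rw [phiTerm, div_eq_mul_inv, mul_inv, hinv]
  simp only [norm_mul, norm_pow, norm_neg, norm_one, one_pow, one_mul]
  calc _ ≤ ‖q‖ ^ j.choose 2 * (‖b‖ + ‖c‖) ^ j * (M₁ * (M₃ * M₂)) := by
        gcongr
        exacts [hM₁ j, hM₃ N, hM₂ _]
    _ = _ := by ring

theorem summable_phiTerm {q c : ℂ} (hq : ‖q‖ < 1) (hc : ‖c‖ < 1) (b : ℂ) :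
    Summable (phiTerm q b c) := by
  obtain ⟨M, hM⟩ := exists_phiTerm_bound hq hc b
  exact .of_norm_bounded ((summable_pow_choose_two (norm_nonneg q) hq _).mul_left M)
    fun j => by simpa using hM 0 j

theorem tsum_phiTerm_shift {q c : ℂ} (hq : ‖q‖ < 1) (hc : ‖c‖ < 1) (b : ℂ) :
    (1 - c) * ∑' j, phiTerm q b c j = (1 - b) * ∑' j, phiTerm q (b * q) (c * q) j := by
  have hc' : ‖c * q‖ < 1 := by
    rw [norm_mul]; exact mul_lt_one_of_nonneg_of_lt_one_left (norm_nonneg _) hc hq.le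
  have hs := summable_phiTerm hq hc b
  have hs' := summable_phiTerm hq hc' (b * q)
  have h := ((hs.mul_left (1 - c)).sub (hs'.mul_left (1 - b))).hasSum.tendsto_sum_nat
  rw [(hs.mul_left (1 - c)).tsum_sub (hs'.mul_left (1 - b)), tsum_mul_left, tsum_mul_left] at h
  simp_rw [phiTerm_telescope hq hc] at h
  simp_rw [Finset.sum_range_sub' (fun j => (1 - c) * (1 - q ^ j) * phiTerm q b c j)] at h
  have h2 : Filter.Tendsto (fun n => (1 - c) * (1 - q ^ 0) * phiTerm q b c 0 -
      (1 - c) * (1 - q ^ n) * phiTerm q b c n) Filter.atTop (nhds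
      ((1 - c) * (1 - q ^ 0) * phiTerm q b c 0 - (1 - c) * (1 - 0) * 0)) :=
    tendsto_const_nhds.sub ((((tendsto_pow_atTop_nhds_zero_of_norm_lt_one hq).const_sub 1).const_mul
      (1 - c)).mul hs.tendsto_atTop_zero)
  have := tendsto_nhds_unique h h2
  simpa [sub_eq_zero] using this

theorem qPoch_mul_tsum_phiTerm {q c : ℂ} (hq : ‖q‖ < 1) (hc : ‖c‖ < 1) (b : ℂ) (N : ℕ) :
    qPoch c q N * ∑' j, phiTerm q b c j =
      qPoch b q N * ∑' j, phiTerm q (b * q ^ N) (c * q ^ N) j := by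
  induction N with
  | zero => simp
  | succ N ih =>
    have hc' : ‖c * q ^ N‖ < 1 := by
      rw [norm_mul, norm_pow]
      exact mul_lt_one_of_nonneg_of_lt_one_left (norm_nonneg _) hc
        (pow_le_one₀ (norm_nonneg _) hq.le)
    have := tsum_phiTerm_shift hq hc' (b * q ^ N)
    rw [qPoch_succ, qPoch_succ, mul_right_comm, ih, mul_right_comm, mul_assoc, mul_comm _ (1 - _),
      this, pow_succ, mul_assoc b, mul_assoc c]
    ring

theorem tendsto_tsum_phiTerm {q c : ℂ} (hq : ‖q‖ < 1) (hc : ‖c‖ < 1) (b : ℂ) :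
    Filter.Tendsto (fun N : ℕ => ∑' j, phiTerm q (b * q ^ N) (c * q ^ N) j)
      Filter.atTop (nhds 1) := by
  obtain ⟨M, hM⟩ := exists_phiTerm_bound hq hc b
  have key : ∀ j, Filter.Tendsto (fun N : ℕ => phiTerm q (b * q ^ N) (c * q ^ N) j)
      Filter.atTop (nhds (if j = 0 then 1 else 0)) := by
    intro j
    have hz (a : ℂ) : Filter.Tendsto (fun N : ℕ => a * q ^ N) Filter.atTop (nhds 0) := by
      simpa using (tendsto_pow_atTop_nhds_zero_of_norm_lt_one hq).const_mul a
    have h1 : Filter.Tendsto (fun N : ℕ => ∏ i ∈ range j, (b * q ^ N - c * q ^ N * q ^ i))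
        Filter.atTop (nhds (∏ i ∈ range j, (0 - 0 * q ^ i))) :=
      tendsto_finsetProd _ fun i _ => (hz b).sub ((hz c).mul_const _)
    have h2 : Filter.Tendsto (fun N : ℕ => qPoch (c * q ^ N) q j)
        Filter.atTop (nhds (∏ i ∈ range j, (1 - 0 * q ^ i))) :=
      tendsto_finsetProd _ fun i _ => ((hz c).mul_const _).const_sub 1
    have h := (h1.const_mul ((-1) ^ j * q ^ j.choose 2)).div (h2.const_mul (qPoch q q j))
      (by simpa using qPoch_ne_zero hq hq j)
    have hlim : (if j = 0 then (1 : ℂ) else 0) = (-1) ^ j * q ^ j.choose 2 *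
        (∏ i ∈ range j, (0 - 0 * q ^ i)) / (qPoch q q j * ∏ i ∈ range j, (1 - 0 * q ^ i)) := by
      rcases j with _ | j <;> simp
    rw [hlim]
    exact h
  have := tendsto_tsum_of_dominated_convergence
    ((summable_pow_choose_two (norm_nonneg q) hq (‖b‖ + ‖c‖)).mul_left M) key
    (Filter.Eventually.of_forall hM)
  simpa using this

/-- The limiting `q`-Gauss sum `∑ (c/b)_j (-b)^j q^{j(j-1)/2} / ((q)_j (c)_j) = (b)_∞ / (c)_∞`. -/
theorem hasSum_phiTerm {q c : ℂ} (hq : ‖q‖ < 1) (hc : ‖c‖ < 1) (b : ℂ) :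
    HasSum (phiTerm q b c) (qPochInf b q / qPochInf c q) := by
  have h := tendsto_nhds_unique
    (((tendsto_qPoch c hq).mul_const _).congr (qPoch_mul_tsum_phiTerm hq hc b))
    ((tendsto_qPoch b hq).mul (tendsto_tsum_phiTerm hq hc b))
  rw [mul_one, mul_comm, ← eq_div_iff (qPochInf_ne_zero hc hq)] at h
  exact h ▸ (summable_phiTerm hq hc b).hasSum

/-! ### Sums of Euler, Cauchy and Gauss type -/

theorem HasSum.of_eq {ι : Type*} {f g : ι → ℂ} {a b : ℂ} (h : HasSum f a) (hf : ∀ i, g i = f i)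
    (ha : b = a) : HasSum g b := by
  rw [ha, funext hf]; exact h

theorem norm_pow_succ_lt_one {q : ℂ} (hq : ‖q‖ < 1) (k : ℕ) : ‖q ^ (k + 1)‖ < 1 := by
  rw [norm_pow]; exact pow_lt_one₀ (norm_nonneg _) hq k.succ_ne_zero

theorem qPoch_self_add (q : ℂ) (m n : ℕ) :
    qPoch q q (m + n) = qPoch q q m * qPoch (q ^ (m + 1)) q n := by
  rw [qPoch_add, pow_succ']

theorem qPochInf_self_eq_mul {q : ℂ} (hq : ‖q‖ < 1) (m : ℕ) :
    qPochInf q q = qPoch q q m * qPochInf (q ^ (m + 1)) q := by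
  rw [qPochInf_eq_mul q hq m, pow_succ']

theorem two_mul_choose_two_add (j : ℕ) : 2 * j.choose 2 + j = j ^ 2 := by
  induction j with
  | zero => rfl
  | succ j ih => rw [Nat.choose_succ_succ j 1, Nat.choose_one_right]; nlinarith

/-- Euler's expansion of `(z)_∞`. -/
theorem hasSum_euler {q : ℂ} (hq : ‖q‖ < 1) (z : ℂ) :
    HasSum (fun j : ℕ => (-1) ^ j * q ^ j.choose 2 * z ^ j / qPoch q q j) (qPochInf z q) := by
  have h := hasSum_phiTerm hq (c := 0) (by simp) z
  refine h.of_eq (fun j => ?_) ?_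
  · simp [phiTerm, qPoch]
  · simp [qPochInf]

/-- Cauchy's sum `∑ q^{j²+kj} / ((q)_j (q)_{j+k}) = 1 / (q)_∞`. -/
theorem hasSum_cauchy {q : ℂ} (hq : ‖q‖ < 1) (k : ℕ) :
    HasSum (fun j : ℕ => q ^ (j ^ 2 + k * j) / (qPoch q q j * qPoch q q (j + k)))
      (qPochInf q q)⁻¹ := by
  have h := (hasSum_phiTerm hq (norm_pow_succ_lt_one hq k) 0).mul_left (qPoch q q k)⁻¹
  refine h.of_eq (fun j => ?_) ?_
  · have hprod : ∏ i ∈ range j, (0 - q ^ (k + 1) * q ^ i) =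
        (-1) ^ j * q ^ ((k + 1) * j) * q ^ j.choose 2 := by
      induction j with
      | zero => simp
      | succ j ih =>
        rw [prod_range_succ, ih, Nat.choose_succ_succ j 1, Nat.choose_one_right]; ring
    have he : j ^ 2 + k * j = j.choose 2 + ((k + 1) * j + j.choose 2) := by
      rw [← two_mul_choose_two_add]; ring
    have hs : ((-1 : ℂ) ^ j) * (-1) ^ j = 1 := by rw [← mul_pow]; simp
    rw [phiTerm, hprod, add_comm j k, qPoch_self_add, he, pow_add, pow_add]
    calc _ = ((-1 : ℂ) ^ j * (-1) ^ j) * (q ^ j.choose 2 * (q ^ ((k + 1) * j) * q ^ j.choose 2) /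
          (qPoch q q j * (qPoch q q k * qPoch (q ^ (k + 1)) q j))) := by rw [hs, one_mul]
      _ = _ := by simp only [div_eq_mul_inv, mul_inv]; ring
  · rw [qPochInf_self_eq_mul hq k]
    simp [qPochInf, mul_comm]

/-- Write 1 = (1 - x) + x with x = q^(j+k+1): the two pieces are Cauchy's sums for k and k + 1. This
yields γ_r for δ_n = q^(n²), with k = 2r. -/
theorem hasSum_cauchy_succ {q : ℂ} (hq : ‖q‖ < 1) (k : ℕ) :
    HasSum (fun j : ℕ => q ^ (j ^ 2 + k * j) / (qPoch q q j * qPoch q q (j + k + 1)))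
      ((1 + q ^ (k + 1)) * (qPochInf q q)⁻¹) := by
  have h := (hasSum_cauchy hq k).add ((hasSum_cauchy hq (k + 1)).mul_left (q ^ (k + 1)))
  refine h.of_eq (fun j => ?_) ?_
  · have h1 := one_sub_mul_pow_ne_zero hq hq (j + k)
    have h2 := qPoch_ne_zero hq hq (j + k)
    have h3 := qPoch_ne_zero hq hq j
    rw [← add_assoc, qPoch_succ]
    have : q ^ (k + 1) * (q ^ (j ^ 2 + (k + 1) * j) / (qPoch q q j *
        (qPoch q q (j + k) * (1 - q * q ^ (j + k))))) = q ^ (j ^ 2 + k * j) * (q * q ^ (j + k)) /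
          (qPoch q q j * (qPoch q q (j + k) * (1 - q * q ^ (j + k)))) := by ring
    rw [this]
    generalize q * q ^ (j + k) = x at *
    field_simp
    ring
  · ring

/-- The q-Gauss limit at b = -q^(r+1), c = q^(2r+2). -/
theorem hasSum_gauss_neg {q : ℂ} (hq : ‖q‖ < 1) (r : ℕ) :
    HasSum (fun j : ℕ => q ^ ((j + 1).choose 2 + j * r) * qPoch (-q) q (j + r) /
      (qPoch q q j * qPoch q q (j + 2 * r + 1))) (qPochInf (-q) q / qPochInf q q) := by
  have h := (hasSum_phiTerm hq (norm_pow_succ_lt_one hq (2 * r + 1)) (-q ^ (r + 1))).mul_left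
    (qPoch (-q) q r / qPoch q q (2 * r + 1))
  refine h.of_eq (fun j => ?_) ?_
  · have hprod : ∏ i ∈ range j, (-q ^ (r + 1) - q ^ (2 * r + 1 + 1) * q ^ i) =
        (-1) ^ j * q ^ ((r + 1) * j) * qPoch (-q * q ^ r) q j := by
      induction j with
      | zero => simp
      | succ j ih => rw [prod_range_succ, ih, qPoch_succ]; ring
    have he : (j + 1).choose 2 + j * r = j.choose 2 + (r + 1) * j := by
      rw [Nat.choose_succ_succ j 1, Nat.choose_one_right]; ring
    have hs : ((-1 : ℂ) ^ j) * (-1) ^ j = 1 := by rw [← mul_pow]; simp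
    rw [phiTerm, hprod, add_comm j r, qPoch_add, he, pow_add,
      show j + 2 * r + 1 = 2 * r + 1 + j by ring, qPoch_self_add]
    calc _ = ((-1 : ℂ) ^ j * (-1) ^ j) * (q ^ j.choose 2 * q ^ ((r + 1) * j) *
          (qPoch (-q) q r * qPoch (-q * q ^ r) q j) / (qPoch q q j *
            (qPoch q q (2 * r + 1) * qPoch (q ^ (2 * r + 1 + 1)) q j))) := by rw [hs, one_mul]
      _ = _ := by simp only [div_eq_mul_inv, mul_inv]; ring
  · rw [qPochInf_self_eq_mul hq (2 * r + 1), qPochInf_eq_mul (-q) hq r, div_mul_div_comm]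
    ring_nf

/-! ### Jacobi's triple product -/

/-- Pairs of natural numbers, indexed by their difference and their minimum. -/
def intNatEquiv : ℤ × ℕ ≃ ℕ × ℕ where
  toFun p := (p.2 + p.1.toNat, p.2 + (-p.1).toNat)
  invFun p := ((p.1 : ℤ) - p.2, min p.1 p.2)
  left_inv := by rintro ⟨k, j⟩; ext <;> dsimp only <;> omega
  right_inv := by rintro ⟨a, b⟩; ext <;> simp <;> omega

theorem int_choose_two_cast (k : ℕ) : (k : ℤ) * (k - 1) / 2 = (k.choose 2 : ℕ) := by
  have := two_mul_choose_two_add k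
  have h : (2 * (k.choose 2 : ℕ) + k : ℤ) = k ^ 2 := by exact_mod_cast this
  have : (k : ℤ) * (k - 1) = 2 * (k.choose 2 : ℕ) := by linarith
  rw [this]; simp

/-- In the product of the Euler series for (z)_∞ and (q/z)_∞, the pairs of indices with difference m
carry the power z^m, and their sum over the minimum j is Cauchy's sum with k = |m|. -/
theorem hasSum_jacobi_fiber {q z : ℂ} (hq : ‖q‖ < 1) (hz : z ≠ 0) (m : ℤ) :
    HasSum (fun j : ℕ => ((fun p : ℕ × ℕ =>
      ((-1) ^ p.1 * q ^ p.1.choose 2 * z ^ p.1 / qPoch q q p.1) *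
      ((-1) ^ p.2 * q ^ p.2.choose 2 * (q / z) ^ p.2 / qPoch q q p.2)) ∘ intNatEquiv) (m, j))
      ((-1) ^ m * q ^ (m * (m - 1) / 2) * z ^ m * (qPochInf q q)⁻¹) := by
  have hs (j k : ℕ) : ((-1 : ℂ) ^ (j + k)) * (-1) ^ j = (-1) ^ k := by
    rw [← pow_add, show j + k + j = 2 * j + k by ring, pow_add, pow_mul]; simp
  have hc (j k : ℕ) : (j + k).choose 2 + j.choose 2 + j = k.choose 2 + (j ^ 2 + k * j) := by
    have e1 := two_mul_choose_two_add (j + k)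
    have e2 := two_mul_choose_two_add j
    have e3 := two_mul_choose_two_add k
    nlinarith
  have hzq (j k : ℕ) : z ^ (j + k) * (q / z) ^ j = q ^ j * z ^ k := by
    rw [div_pow, pow_add]; field_simp
  have hzq' (j k : ℕ) : z ^ j * (q / z) ^ (j + k) = q ^ (j + k) * (z ^ k)⁻¹ := by
    rw [div_pow, pow_add z]; field_simp
  obtain ⟨k, rfl | rfl⟩ := m.eq_nat_or_neg
  · refine ((hasSum_cauchy hq k).mul_left ((-1) ^ k * q ^ k.choose 2 * z ^ k)).of_eq
      (fun j => ?_) ?_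
    · simp only [intNatEquiv, Function.comp, Equiv.coe_fn_mk, Int.toNat_natCast,
        Int.toNat_neg_natCast, add_zero]
      rw [div_mul_div_comm, mul_div_assoc', mul_comm (qPoch q q (j + k)), ← hs j k]
      congr 1
      have : q ^ (j + k).choose 2 * q ^ j.choose 2 * q ^ j = q ^ k.choose 2 * q ^ (j ^ 2 + k * j) := by
        rw [← pow_add, ← pow_add, ← pow_add, hc]
      calc _ = (-1) ^ (j + k) * (-1) ^ j *
            (q ^ (j + k).choose 2 * q ^ j.choose 2) * (q ^ j * z ^ k) := by
            rw [← hzq j k]; ring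
        _ = _ := by linear_combination (-1) ^ (j + k) * (-1) ^ j * z ^ k * this
    · rw [int_choose_two_cast]; simp
  · refine ((hasSum_cauchy hq k).mul_left ((-1) ^ k * q ^ (k.choose 2 + k) * (z ^ k)⁻¹)).of_eq
      (fun j => ?_) ?_
    · simp only [intNatEquiv, Function.comp, Equiv.coe_fn_mk, Int.toNat_natCast,
        Int.toNat_neg_natCast, add_zero, neg_neg]
      rw [div_mul_div_comm, mul_div_assoc', ← hs j k]
      congr 1
      have : q ^ (j + k).choose 2 * q ^ j.choose 2 * q ^ (j + k) =
          q ^ (k.choose 2 + k) * q ^ (j ^ 2 + k * j) := by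
        rw [← pow_add, ← pow_add, ← pow_add]; congr 1; have := hc j k; omega
      calc _ = (-1) ^ (j + k) * (-1) ^ j *
            (q ^ (j + k).choose 2 * q ^ j.choose 2) * (q ^ (j + k) * (z ^ k)⁻¹) := by
            rw [← hzq' j k]; ring
        _ = _ := by linear_combination (-1) ^ (j + k) * (-1) ^ j * (z ^ k)⁻¹ * this
    · have : (-(k : ℤ)) * (-k - 1) / 2 = (k.choose 2 + k : ℕ) := by
        rw [show (-(k : ℤ)) * (-k - 1) = k * (k - 1) + k * 2 by ring,
          Int.add_mul_ediv_right _ _ two_ne_zero, int_choose_two_cast]; simp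
      rw [this, zpow_natCast, zpow_neg, zpow_neg, zpow_natCast, zpow_natCast,
        show ((-1 : ℂ) ^ k)⁻¹ = (-1) ^ k by rw [← inv_pow]; norm_num]

theorem hasSum_mul_prod {ι κ : Type*} {f : ι → ℂ} {g : κ → ℂ} {a b : ℂ} (hf : HasSum f a)
    (hg : HasSum g b) : HasSum (fun p : ι × κ => f p.1 * g p.2) (a * b) :=
  HasSum.mul hf hg (summable_mul_of_summable_norm hf.summable.norm hg.summable.norm)

/-- Jacobi's triple product identity. -/
theorem hasSum_jacobi {q z : ℂ} (hq : ‖q‖ < 1) (hz : z ≠ 0) :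
    HasSum (fun m : ℤ => (-1) ^ m * q ^ (m * (m - 1) / 2) * z ^ m)
      (qPochInf z q * qPochInf (q / z) q * qPochInf q q) := by
  have h1 := hasSum_euler hq z
  have h2 := hasSum_euler hq (q / z)
  have h := hasSum_mul_prod h1 h2
  rw [← intNatEquiv.hasSum_iff] at h
  have hfib : ∀ m : ℤ, HasSum (fun j : ℕ => ((fun p : ℕ × ℕ =>
      ((-1) ^ p.1 * q ^ p.1.choose 2 * z ^ p.1 / qPoch q q p.1) *
      ((-1) ^ p.2 * q ^ p.2.choose 2 * (q / z) ^ p.2 / qPoch q q p.2)) ∘ intNatEquiv) (m, j))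
      ((-1) ^ m * q ^ (m * (m - 1) / 2) * z ^ m * (qPochInf q q)⁻¹) := fun m =>
    hasSum_jacobi_fiber hq hz m
  have h3 := (HasSum.prod_fiberwise h hfib).mul_right (qPochInf q q)
  refine h3.of_eq (fun m => ?_) rfl
  rw [mul_assoc _ _ (qPochInf q q), inv_mul_cancel₀ (qPochInf_ne_zero hq hq), mul_one]

/-- Nonnegative exponents replace x ≠ 0, so that q = 0 needs no separate treatment later. -/
theorem zpow_add_of_nonneg_exponents (x : ℂ) {a b : ℤ} (ha : 0 ≤ a) (hb : 0 ≤ b) :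
    x ^ (a + b) = x ^ a * x ^ b := by
  lift a to ℕ using ha
  lift b to ℕ using hb
  exact_mod_cast pow_add x a b

theorem exists_sq_eq_two_mul_add (m : ℤ) : ∃ t : ℤ, m ^ 2 = 2 * t + m := by
  obtain ⟨t, ht⟩ := Int.even_mul_pred_self m
  exact ⟨t, by linarith⟩

theorem qPochInf_zero_base {a : ℂ} (ha : a = 0) : qPochInf a 0 = 1 := by
  simp [qPochInf, ha]

/-- Jacobi's triple product identity in base `q ^ (a + b)` at `z = q ^ a`. -/
theorem hasSum_jacobi_pow {q : ℂ} (hq : ‖q‖ < 1) {a b c : ℕ} (ha : 0 < a) (hb : 0 < b)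
    (hc : a + b = c) :
    HasSum (fun m : ℤ => (-1) ^ m * q ^ ((c * m ^ 2 + (a - b) * m) / 2))
      (qPochInf₃ (q ^ b) (q ^ a) (q ^ c) (q ^ c)) := by
  have hc0 : c ≠ 0 := by omega
  -- At q = 0 the point z = q^a is not admissible in `hasSum_jacobi`; there only the term m = 0
  -- survives.
  rcases eq_or_ne q 0 with rfl | hq0
  · have h := hasSum_single (f := fun m : ℤ => (-1 : ℂ) ^ m * 0 ^ ((c * m ^ 2 + (a - b) * m) / 2))
      0 fun m hm => ?_
    · simpa [qPochInf₃, qPochInf_zero_base, zero_pow, ha.ne', hb.ne', hc0] using h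
    · have h2 : 2 ≤ c * m ^ 2 + (a - b) * m := by
        have ha' : (1 : ℤ) ≤ a := by exact_mod_cast ha
        have hb' : (1 : ℤ) ≤ b := by exact_mod_cast hb
        -- For m ≠ 0 both products of consecutive integers are nonnegative and one is at least 2, so
        -- the halved exponent is positive.
        have e : c * m ^ 2 + (a - b) * m = a * (m * (m + 1)) + b * (m * (m - 1)) := by
          rw [← hc]; push_cast; ring
        rw [e]
        rcases lt_or_gt_of_ne hm with h | h
        · have h1 : 2 ≤ m * (m - 1) := by nlinarith
          have h3 : 0 ≤ m * (m + 1) := by nlinarith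
          nlinarith [mul_nonneg (by omega : (0 : ℤ) ≤ a) h3]
        · have h1 : 2 ≤ m * (m + 1) := by nlinarith
          have h3 : 0 ≤ m * (m - 1) := by nlinarith
          nlinarith [mul_nonneg (by omega : (0 : ℤ) ≤ b) h3]
      rw [zero_zpow _ (by omega), mul_zero]
  · have hqc : ‖q ^ c‖ < 1 := by rw [norm_pow]; exact pow_lt_one₀ (norm_nonneg _) hq hc0
    refine (hasSum_jacobi (z := q ^ a) hqc (pow_ne_zero a hq0)).of_eq (fun m => ?_) ?_
    · obtain ⟨t, ht⟩ := exists_sq_eq_two_mul_add m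
      have e1 : m * (m - 1) / 2 = t := by
        rw [show m * (m - 1) = 2 * t by linarith]; omega
      have e2 : (c * m ^ 2 + (a - b) * m) / 2 = c * t + a * m := by
        rw [ht, ← hc]; push_cast
        rw [show ((a : ℤ) + b) * (2 * t + m) + (a - b) * m = 2 * ((a + b) * t + a * m) by ring]
        exact Int.mul_ediv_cancel_left _ two_ne_zero
      rw [e1, e2, zpow_add₀ hq0, zpow_mul, zpow_mul, zpow_natCast, zpow_natCast, mul_assoc]
    · rw [qPochInf₃, ← hc, pow_add, mul_div_cancel_left₀ _ (pow_ne_zero a hq0)]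
      ring

/-! ### Bailey's transform relative to a = q -/

/-- The index `r` of the Bailey pair entry `α_r` attached to the integer `m`: `r = 2m` for `m ≥ 0`
and `r = -2m - 1` for `m < 0`. -/
def foldIndex (m : ℤ) : ℕ := if 0 ≤ m then (2 * m).toNat else (-2 * m - 1).toNat

theorem foldIndex_cast (m : ℤ) :
    0 ≤ m ∧ (foldIndex m : ℤ) = 2 * m ∨ m < 0 ∧ (foldIndex m : ℤ) = -2 * m - 1 := by
  unfold foldIndex; split <;> omega

/-- The lower index n - 2m is n - r for m ≥ 0 and n + r + 1 for m < 0; these are complementary in 2n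
+ 1, so both signs give the same Bailey kernel. -/
theorem qBinom_div_qPoch {q : ℂ} (hq : ‖q‖ < 1) (n : ℕ) (m : ℤ) :
    qBinom q (2 * n + 1) (n - 2 * m) / qPoch q q (2 * n + 1) =
      if foldIndex m ≤ n then
        (qPoch q q (n - foldIndex m) * qPoch q q (n + foldIndex m + 1))⁻¹ else 0 := by
  have hP := qPoch_ne_zero hq hq (2 * n + 1)
  have hm := foldIndex_cast m
  generalize foldIndex m = r at *
  by_cases hr : r ≤ n
  · rw [qBinom, if_pos (by push_cast; omega), if_pos hr]
    rcases hm with ⟨_, hm⟩ | ⟨_, hm⟩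
    · rw [show ((n : ℤ) - 2 * m).toNat = n - r by omega,
        show 2 * n + 1 - (n - r) = n + r + 1 by omega]
      field_simp
    · rw [show ((n : ℤ) - 2 * m).toNat = n + r + 1 by omega,
        show 2 * n + 1 - (n + r + 1) = n - r by omega]
      field_simp
  · rw [qBinom, if_neg (by push_cast; omega), if_neg hr, zero_div]

/-- Bailey's transform for pairs relative to `a = q` whose entries `α_r` are indexed by `ℤ` through
`foldIndex`. -/
theorem hasSum_bailey {q : ℂ} (hq : ‖q‖ < 1) {α : ℤ → ℂ} {δ γ : ℕ → ℂ} (hα : Summable α)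
    (hδ : Summable δ)
    (hγ : ∀ r, HasSum (fun j => δ (j + r) / (qPoch q q j * qPoch q q (j + 2 * r + 1))) (γ r))
    {A : ℂ} (hA : HasSum (fun m => α m * γ (foldIndex m)) A) :
    HasSum (fun n : ℕ => ∑ m ∈ Icc (-(((n : ℤ) + 1) / 2)) ((n : ℤ) / 2),
      α m * δ n * (qBinom q (2 * n + 1) (n - 2 * m) / qPoch q q (2 * n + 1))) A := by
  set F : ℕ × ℤ → ℂ := fun p =>
    α p.2 * δ p.1 * (qBinom q (2 * p.1 + 1) (p.1 - 2 * p.2) / qPoch q q (2 * p.1 + 1)) with hF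
  obtain ⟨M, hM0, hM⟩ := exists_norm_inv_qPoch_le hq hq
  -- The kernel is bounded by M², so the double family is dominated by |δ_n α_m| and may be summed
  -- in either order.
  have hsum : Summable F := by
    refine .of_norm_bounded ((summable_mul_of_summable_norm hδ.norm.norm hα.norm.norm).mul_right
      (M * M)) fun p => ?_
    rw [hF]
    simp only [norm_mul]
    rw [mul_comm ‖α p.2‖]
    refine mul_le_mul_of_nonneg_left ?_ (by positivity)
    rw [qBinom_div_qPoch hq]
    split_ifs
    · rw [mul_inv, norm_mul]
      exact mul_le_mul (hM _) (hM _) (norm_nonneg _) hM0.le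
    · rw [norm_zero]; positivity
  have hrow : ∀ n : ℕ, HasSum (fun m : ℤ => F (n, m))
      (∑ m ∈ Icc (-(((n : ℤ) + 1) / 2)) ((n : ℤ) / 2), F (n, m)) := fun n => by
    refine hasSum_sum_of_ne_finset_zero fun m hm => ?_
    have := foldIndex_cast m
    rw [mem_Icc] at hm
    simp only [hF]
    -- The interval for m is exactly the condition r ≤ n.
    rw [qBinom_div_qPoch hq, if_neg (by omega), mul_zero]
  have hcol : ∀ m : ℤ, HasSum (fun n : ℕ => F (n, m)) (α m * γ (foldIndex m)) := fun m => by
    rw [← (add_left_injective (foldIndex m)).hasSum_iff]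
    · refine ((hγ (foldIndex m)).mul_left (α m)).of_eq (fun j => ?_) rfl
      simp only [hF, Function.comp]
      rw [qBinom_div_qPoch hq, if_pos (by omega), Nat.add_sub_cancel,
        show j + foldIndex m + foldIndex m + 1 = j + 2 * foldIndex m + 1 by ring]
      ring
    · intro n hn
      simp only [hF]
      rw [qBinom_div_qPoch hq, if_neg, mul_zero]
      exact fun h => hn ⟨n - foldIndex m, Nat.sub_add_cancel h⟩
  have h1 := HasSum.prod_fiberwise hsum.hasSum hrow
  have h2 := HasSum.prod_fiberwise ((Equiv.prodComm ℤ ℕ).hasSum_iff.mpr hsum.hasSum) hcol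
  rwa [h2.unique hA] at h1

/-! ### The two choices of δ -/

/-- Since (q)_n (-q)_n = (q²;q²)_n, this separates (q)_(2n+1) into odd and even factors; it accounts
for the factor (-q)_n in δ_n. -/
theorem qPoch_mul_qPoch_odd (q : ℂ) (n : ℕ) :
    qPoch q q n * qPoch q (q ^ 2) (n + 1) * qPoch (-q) q n = qPoch q q (2 * n + 1) := by
  induction n with
  | zero => simp [qPoch]
  | succ n ih =>
    rw [show 2 * (n + 1) + 1 = 2 * n + 1 + 1 + 1 by ring, qPoch_succ q q (2 * n + 1 + 1),
      qPoch_succ q q (2 * n + 1), ← ih, qPoch_succ q q n, qPoch_succ (-q) q n,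
      qPoch_succ q (q ^ 2) (n + 1)]
    ring

/-- The entries `α` of the Bailey pair. -/
noncomputable def alphaTerm (q : ℂ) (m : ℤ) : ℂ := (-1) ^ m * q ^ (m * (5 * m + 3) / 2)

theorem summable_alphaTerm {q : ℂ} (hq : ‖q‖ < 1) : Summable (alphaTerm q) := by
  refine (hasSum_jacobi_pow hq (a := 4) (b := 1) (c := 5) (by norm_num) (by norm_num)
    rfl).summable.congr fun m => ?_
  rw [alphaTerm]
  congr 3
  push_cast; ring

theorem alpha_exponent_nonneg (m : ℤ) : 0 ≤ m * (5 * m + 3) / 2 := by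
  refine Int.ediv_nonneg ?_ two_pos.le
  rcases le_or_gt 0 m with h | h <;> nlinarith

theorem summable_pow_of_le {q : ℂ} (hq : ‖q‖ < 1) {e : ℕ → ℕ} (he : ∀ n, n ≤ e n) {u : ℕ → ℂ}
    {M : ℝ} (hu : ∀ n, ‖u n‖ ≤ M) : Summable fun n => q ^ e n * u n := by
  refine .of_norm_bounded ((summable_geometric_of_lt_one (norm_nonneg q) hq).mul_right M)
    fun n => ?_
  rw [norm_mul, norm_pow]
  exact mul_le_mul (pow_le_pow_of_le_one (norm_nonneg _) hq.le (he n)) (hu n) (norm_nonneg _)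
    (by positivity)

theorem hasSum_mod_nine {q : ℂ} (hq : ‖q‖ < 1) :
    HasSum (fun n : ℕ => ∑ m ∈ Icc (-(((n : ℤ) + 1) / 2)) ((n : ℤ) / 2),
      alphaTerm q m * (q ^ (n + 1).choose 2 * qPoch (-q) q n) *
        (qBinom q (2 * n + 1) (n - 2 * m) / qPoch q q (2 * n + 1)))
      (qPochInf (-q) q * qPochInf₃ (q ^ 2) (q ^ 7) (q ^ 9) (q ^ 9) / qPochInf q q) := by
  obtain ⟨M, -, hM⟩ := exists_norm_qPoch_le (-q) hq
  refine hasSum_bailey hq (summable_alphaTerm hq)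
    (δ := fun n => q ^ (n + 1).choose 2 * qPoch (-q) q n)
    (γ := fun r => q ^ (r + 1).choose 2 * (qPochInf (-q) q / qPochInf q q))
    (summable_pow_of_le hq (fun n => ?_) hM) (fun r => ?_) ?_
  · rw [Nat.choose_succ_succ n 1, Nat.choose_one_right]; omega
  · refine ((hasSum_gauss_neg hq r).mul_left (q ^ (r + 1).choose 2)).of_eq (fun j => ?_) rfl
    have he : (j + r + 1).choose 2 = (r + 1).choose 2 + ((j + 1).choose 2 + j * r) := by
      have h1 := two_mul_choose_two_add (j + r + 1)
      have h2 := two_mul_choose_two_add (r + 1)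
      have h3 := two_mul_choose_two_add (j + 1)
      nlinarith
    rw [he, pow_add]
    ring
  · refine ((hasSum_jacobi_pow hq (a := 7) (b := 2) (c := 9) (by norm_num) (by norm_num)
      rfl).mul_right (qPochInf (-q) q / qPochInf q q)).of_eq (fun m => ?_) (by ring)
    rw [← mul_assoc, alphaTerm, mul_assoc _ _ (q ^ _), ← zpow_natCast,
      ← zpow_add_of_nonneg_exponents _ (alpha_exponent_nonneg m) (by positivity)]
    congr 3
    obtain ⟨t, ht⟩ := exists_sq_eq_two_mul_add m
    have h1 : (2 * ((foldIndex m + 1).choose 2 : ℕ) + (foldIndex m + 1) : ℤ) =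
        (foldIndex m + 1) ^ 2 := by exact_mod_cast two_mul_choose_two_add (foldIndex m + 1)
    -- r(r+1)/2 = m(2m+1) for both signs of m; adding the exponent of α_m gives (9m² + 5m)/2.
    have h2 : (((foldIndex m + 1).choose 2 : ℕ) : ℤ) = 4 * t + 3 * m := by
      rcases foldIndex_cast m with ⟨-, h⟩ | ⟨-, h⟩ <;> rw [h] at h1 <;> linarith
    rw [h2, show m * (5 * m + 3) = 2 * (5 * t + 4 * m) by linarith, ht]
    push_cast
    omega

theorem hasSum_mod_thirteen {q : ℂ} (hq : ‖q‖ < 1) :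
    HasSum (fun n : ℕ => ∑ m ∈ Icc (-(((n : ℤ) + 1) / 2)) ((n : ℤ) / 2),
      alphaTerm q m * q ^ (n ^ 2) *
        (qBinom q (2 * n + 1) (n - 2 * m) / qPoch q q (2 * n + 1)))
      (1 / qPochInf q q *
        (qPochInf₃ (q ^ 5) (q ^ 8) (q ^ 13) (q ^ 13) +
          q * qPochInf₃ q (q ^ 12) (q ^ 13) (q ^ 13))) := by
  refine hasSum_bailey hq (summable_alphaTerm hq) (δ := fun n => q ^ (n ^ 2))
    (γ := fun r => q ^ (r ^ 2) * ((1 + q ^ (2 * r + 1)) * (qPochInf q q)⁻¹))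
    ?_ (fun r => ?_) ?_
  · simpa using summable_pow_of_le hq (e := fun n => n ^ 2) (u := fun _ => 1) (M := 1)
      (fun n => Nat.le_self_pow two_ne_zero n) (by simp)
  · refine ((hasSum_cauchy_succ hq (2 * r)).mul_left (q ^ (r ^ 2))).of_eq (fun j => ?_) rfl
    rw [show (j + r) ^ 2 = r ^ 2 + (j ^ 2 + 2 * r * j) by ring, pow_add]
    ring
  · have h1 := hasSum_jacobi_pow hq (a := 8) (b := 5) (c := 13) (by norm_num) (by norm_num) rfl
    have h2 := hasSum_jacobi_pow hq (a := 12) (b := 1) (c := 13) (by norm_num) (by norm_num) rfl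
    rw [pow_one] at h2
    refine ((h1.add (h2.mul_left q)).mul_left (1 / qPochInf q q)).of_eq (fun m => ?_) rfl
    obtain ⟨t, ht⟩ := exists_sq_eq_two_mul_add m
    -- The left side is q^(r²) + q^((r+1)²), and {r², (r+1)²} = {(2m)², (2m+1)²}; the sign of m only
    -- swaps the summands. Each summand yields one theta series modulo 13.
    have hγ : q ^ (foldIndex m ^ 2) * (1 + q ^ (2 * foldIndex m + 1)) =
        q ^ (4 * m ^ 2) + q ^ ((2 * m + 1) ^ 2) := by
      have e : q ^ (foldIndex m ^ 2) * (1 + q ^ (2 * foldIndex m + 1)) =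
          q ^ ((foldIndex m : ℤ) ^ 2) + q ^ (((foldIndex m : ℤ) + 1) ^ 2) := by
        rw [mul_add, ← pow_add, mul_one]
        norm_cast
        rw [show (foldIndex m + 1) ^ 2 = foldIndex m ^ 2 + (2 * foldIndex m + 1) by ring]
      rw [e]
      rcases foldIndex_cast m with ⟨-, h⟩ | ⟨-, h⟩ <;> rw [h]
      · congr 2; ring
      · rw [add_comm]; congr 2 <;> ring
    have hα : m * (5 * m + 3) / 2 = 5 * t + 4 * m := by
      rw [show m * (5 * m + 3) = 2 * (5 * t + 4 * m) by linarith]; omega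
    have h0 := alpha_exponent_nonneg m
    have e1 : q ^ (m * (5 * m + 3) / 2) * q ^ (4 * m ^ 2) =
        q ^ (((13 : ℕ) * m ^ 2 + ((8 : ℕ) - (5 : ℕ)) * m) / 2) := by
      rw [← zpow_add_of_nonneg_exponents _ h0 (by positivity), hα, ht]
      congr 1; push_cast; omega
    have e2 : q ^ (m * (5 * m + 3) / 2) * q ^ ((2 * m + 1) ^ 2) =
        q * q ^ (((13 : ℕ) * m ^ 2 + ((12 : ℕ) - (1 : ℕ)) * m) / 2) := by
      rw [← zpow_add_of_nonneg_exponents _ h0 (by positivity), ← zpow_one q, ← zpow_mul, one_mul,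
        ← zpow_mul, one_mul, ← zpow_add_of_nonneg_exponents _ zero_le_one, hα]
      · congr 1
        rw [show (2 * m + 1) ^ 2 = 8 * t + 8 * m + 1 by linarith, ht]
        push_cast; omega
      · refine Int.ediv_nonneg ?_ two_pos.le
        push_cast
        rcases le_or_gt 0 m with h | h <;> nlinarith
    calc alphaTerm q m * (q ^ (foldIndex m ^ 2) *
          ((1 + q ^ (2 * foldIndex m + 1)) * (qPochInf q q)⁻¹))
        = (-1) ^ m * (q ^ (m * (5 * m + 3) / 2) * (q ^ (foldIndex m ^ 2) *
          (1 + q ^ (2 * foldIndex m + 1)))) * (qPochInf q q)⁻¹ := by rw [alphaTerm]; ring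
      _ = _ := by rw [hγ, mul_add, e1, e2]; ring

/-- For complex series `HasSum` is unconditional, hence absolute, convergence. -/
theorem mainTheorem2 (q : ℂ) (hq : ‖q‖ < 1) :
    HasSum
      (fun n : ℕ =>
        ∑ m ∈ Finset.Icc (-(((n : ℤ) + 1) / 2)) ((n : ℤ) / 2),
          ((-1 : ℂ) ^ m * q ^ ((n : ℤ) * ((n : ℤ) + 1) / 2 + m * (5 * m + 3) / 2)) /
              (qPoch q q n * qPoch q (q ^ 2) (n + 1)) *
            qBinom q (2 * n + 1) ((n : ℤ) - 2 * m))
      (qPochInf (-q) q * qPochInf₃ (q ^ 2) (q ^ 7) (q ^ 9) (q ^ 9) / qPochInf q q) ∧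
    HasSum
      (fun n : ℕ =>
        ∑ m ∈ Finset.Icc (-(((n : ℤ) + 1) / 2)) ((n : ℤ) / 2),
          ((-1 : ℂ) ^ m * q ^ ((n : ℤ) ^ 2 + m * (5 * m + 3) / 2)) /
              qPoch q q (2 * n + 1) *
            qBinom q (2 * n + 1) ((n : ℤ) - 2 * m))
      (1 / qPochInf q q *
        (qPochInf₃ (q ^ 5) (q ^ 8) (q ^ 13) (q ^ 13) +
          q * qPochInf₃ q (q ^ 12) (q ^ 13) (q ^ 13))) := by
  refine ⟨(hasSum_mod_nine hq).of_eq (fun n => sum_congr rfl fun m _ => ?_) rfl,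
    (hasSum_mod_thirteen hq).of_eq (fun n => sum_congr rfl fun m _ => ?_) rfl⟩
  · have hn : (n : ℤ) * (n + 1) / 2 = ((n + 1).choose 2 : ℕ) := by
      rw [← int_choose_two_cast]; push_cast; ring_nf
    have hprod := qPoch_mul_qPoch_odd q n
    have hne : qPoch (-q) q n ≠ 0 := qPoch_ne_zero (by rwa [norm_neg]) hq n
    rw [hn, zpow_add_of_nonneg_exponents _ (by positivity) (alpha_exponent_nonneg m), zpow_natCast,
      alphaTerm, ← hprod]
    -- Numerator and denominator are multiplied by (-q)_n to bring in (q)_(2n+1).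
    rw [← mul_div_mul_right _ (qPoch q q n * qPoch q (q ^ 2) (n + 1)) hne]
    ring
  · rw [zpow_add_of_nonneg_exponents _ (by positivity) (alpha_exponent_nonneg m), alphaTerm]
    norm_cast
    ring
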